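/- For $\theta\in\mathbb R$ let $|\theta\rangle=\cos\theta\,|0\rangle+\sin\theta\,|1\rangle\in\mathbb C^2$ and consider the three-qubit product states, shared by three spatially separated parties holding one qubit each, $$|\psi_1\rangle=|0\rangle|0\rangle|0\rangle,\qquad |\psi_2\rangle=|0\rangle|\theta\rangle|\theta\rangle,\qquad |\psi_3\rangle=|\theta\rangle|0\rangle|\theta\rangle ,\qquad \mathcal S_{NL_2}=\{|\psi_1\rangle,|\psi_2\rangle,|\psi_3\rangle\}.$$ Definitions. A finite family of states $(\rho_j)_j$ is *antidistinguishable* if there is a POVM $(\Pi_j)_j$, indexed like the family, with $\operatorname{Tr}(\rho_j\Pi_j)=0$ for all $j$ and $\sum_i\operatorname{Tr}(\rho_i\Pi_j)>0$ for all $j$. An *LOCC protocol* consists of finitely many rounds in each of which one party performs a generalized measurement on its own system (local ancillas are allowed) and broadcasts the outcome, on which the continuation may depend. For $1\le n\le 3$ let $\mathcal S^{[n]}_{NL_2}$ be the family of the states $|\psi_{i_1}\rangle\otimes\dots\otimes|\psi_{i_n}\rangle$ with pairwise distinct $i_1,\dots,i_n$, each party holding its share of all $n$ states. A family of multipartite states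 admits *CLSD* (is locally conclusively distinguishable) if some LOCC protocol, which may also answer "inconclusive", never misidentifies the supplied state and identifies each state of the family with nonzero probability. $\mathcal S_{NL_2}$ admits *$n$-CLSM* if $\mathcal S_{NL_2}^{[n]}$ admits CLSD. $\mathcal S_{NL_2}$ admits *$(n,m)$-LSAM* if there is an LOCC protocol which, run on any state of $\mathcal S_{NL_2}^{[n]}$, in every run outputs at least $m$ sequences of $n$ distinct indices, none of which is the sequence of the supplied state. Theorem. Let $\frac\pi4\le\theta\le\frac{3\pi}4$. Then 1. $\mathcal S_{NL_2}$ is globally antidistinguishable, and so is the family $\mathcal S_{NL_2}^{[2]}$ of sequences of two distinct states; 2. $\mathcal S_{NL_2}$ admits CLSD, and it admits $n$-CLSM for every $1\le n\le 3$; 3. if moreover $\theta\in\big[\frac\pi4,\arccos\frac1{\sqrt3}\big)\cup\big(\arccos\big(-\frac1{\sqrt3}\big),\frac{3\pi}4\big]$, then $\mathcal S_{NL_2}$ does not admit $(2,1)$-LSAM. Thus, in the range of part 3, antimarking reveals a nonlocality of $\mathcal S_{NL_2}$ (two-state sequences can be antimarked by global measurements but not by LOCC) that is not seen by CLSD and CLSM.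 -/

import Mathlib

open scoped ComplexOrder

namespace Antimarking

/-! ### Global measurements -/

/-- A positive operator-valued measure with outcomes `ι` on the space `ℂ^n`. -/
structure POVM (ι n : Type) [Fintype ι] [Fintype n] [DecidableEq n] where
  effect : ι → Matrix n n ℂ
  posSemidef : ∀ j, (effect j).PosSemidef
  sum_effect : ∑ j, effect j = 1

/-- The density operator `|ψ⟩⟨ψ|` of a pure state. -/
def density {n : Type} (ψ : n → ℂ) : Matrix n n ℂ :=
  Matrix.vecMulVec ψ (star ψ)

/-- (Strong) antidistinguishability of a finite family of states: a POVM whose outcome `j` never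
occurs in state `j`, and each of whose outcomes occurs for at least one state of the family. -/
def Antidistinguishable {ι n : Type} [Fintype ι] [Fintype n] [DecidableEq n]
    (ρ : ι → Matrix n n ℂ) : Prop :=
  ∃ M : POVM ι n,
    (∀ j, (ρ j * M.effect j).trace = 0) ∧
    ∀ j, 0 < ∑ i, (ρ i * M.effect j).trace.re

/-! ### Multipartite pure states and LOCC

The parties form a finite type `P`, and party `p` holds the space with orthonormal basis `D p`. A
multipartite pure state is given by its amplitudes `(∀ p, D p) → ℂ`. -/

section LOCC

variable {P : Type} [Fintype P] [DecidableEq P]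

/-- The product state `⊗ₚ v p`. -/
def productState {D : P → Type} (v : ∀ p, D p → ℂ) : (∀ p, D p) → ℂ :=
  fun x => ∏ p, v p (x p)

/-- Action of an operator `K` of party `p` (tensored with the identity of all other parties). -/
def applyLocal {D : P → Type} [∀ p, Fintype (D p)] (p : P) (K : Matrix (D p) (D p) ℂ)
    (ψ : (∀ p, D p) → ℂ) : (∀ p, D p) → ℂ :=
  fun x => ∑ a, K (x p) a * ψ (Function.update x p a)

/-- A finite-round LOCC protocol with final outputs in `O`: a decision tree. Either the protocol
stops and announces an output, or some party `p` performs a generalized measurement with Kraus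
operators `K i`, `∑ᵢ (K i)ᴴ (K i) = 1`, broadcasts the outcome `i`, and the parties go on with a
protocol that may depend on `i` (so on the whole history). -/
inductive LOCC (D : P → Type) [∀ p, Fintype (D p)] [∀ p, DecidableEq (D p)] (O : Type) : Type
  | output (o : O) : LOCC D O
  | measure (p : P) (r : ℕ) (K : Fin r → Matrix (D p) (D p) ℂ)
      (complete : ∑ i, (K i).conjTranspose * K i = 1) (next : Fin r → LOCC D O) : LOCC D O

/-- The probability that the protocol announces `o` when it is run on the pure state `ψ`. (The
post-measurement vectors are not renormalized, their squared norm is the branch probability.) -/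
noncomputable def LOCC.prob {D : P → Type} [∀ p, Fintype (D p)] [∀ p, DecidableEq (D p)] {O : Type}
    [DecidableEq O] (o : O) : LOCC D O → ((∀ p, D p) → ℂ) → ℝ
  | .output o', ψ => if o' = o then ∑ x, ‖ψ x‖ ^ 2 else 0
  | .measure p _ K _ next, ψ => ∑ i, LOCC.prob o (next i) (applyLocal p (K i) ψ)

/-- The local spaces after party `p` has attached an ancilla of dimension `a p + 1`. -/
abbrev WithAncilla (D : P → Type) (a : P → ℕ) : P → Type :=
  fun p => D p × Fin (a p + 1)

/-- The state `ψ` with every local ancilla in the state `|0⟩`. -/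
def attachAncilla {D : P → Type} (a : P → ℕ) (ψ : (∀ p, D p) → ℂ) :
    (∀ p, WithAncilla D a p) → ℂ :=
  fun x => if ∀ p, (x p).2 = 0 then ψ (fun p => (x p).1) else 0

/-- A family of multipartite pure states is locally conclusively distinguishable (CLSD): by LOCC
with local ancillas, the state is never misidentified (the output `none` is inconclusive), and each
state is identified with nonzero probability. -/
def AdmitsCLSD {D : P → Type} [∀ p, Fintype (D p)] [∀ p, DecidableEq (D p)]
    {ι : Type} [DecidableEq ι] (ψ : ι → (∀ p, D p) → ℂ) : Prop :=
  ∃ (a : P → ℕ) (L : LOCC (WithAncilla D a) (Option ι)),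
    (∀ i j, i ≠ j → L.prob (some j) (attachAncilla a (ψ i)) = 0) ∧
    ∀ i, 0 < L.prob (some i) (attachAncilla a (ψ i))

/-- The state `|ψ_{s 1}⟩ ⊗ ⋯ ⊗ |ψ_{s n}⟩` for a sequence `s` of `n` distinct indices, regrouped so
that party `p` holds its share of all the `n` states. -/
def seqState {D : P → Type} {ι : Type} (n : ℕ) (ψ : ι → (∀ p, D p) → ℂ) (s : Fin n ↪ ι) :
    (∀ p, Fin n → D p) → ℂ :=
  fun x => ∏ k, ψ (s k) (fun p => x p k)

/-- `n`-CLSM: conclusive local identification of a sequence of `n` states drawn without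
repetition. -/
def AdmitsCLSM {D : P → Type} [∀ p, Fintype (D p)] [∀ p, DecidableEq (D p)]
    {ι : Type} [DecidableEq ι] (n : ℕ) (ψ : ι → (∀ p, D p) → ℂ) : Prop :=
  AdmitsCLSD (D := fun p => Fin n → D p) (seqState n ψ)

/-- `(n,m)`-LSAM: there is an LOCC protocol (with local ancillas) that announces sets of sequences
of `n` distinct indices such that, whichever sequence `s` is supplied, every set announced with
nonzero probability has at least `m` elements and does not contain `s`. -/
def AdmitsLSAM {D : P → Type} [∀ p, Fintype (D p)] [∀ p, DecidableEq (D p)]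
    {ι : Type} [DecidableEq ι] (n m : ℕ) (ψ : ι → (∀ p, D p) → ℂ) : Prop :=
  ∃ (a : P → ℕ) (L : LOCC (WithAncilla (fun p => Fin n → D p) a) (Finset (Fin n ↪ ι))),
    ∀ (s : Fin n ↪ ι) (T : Finset (Fin n ↪ ι)),
      L.prob T (attachAncilla a (seqState n ψ s)) ≠ 0 → m ≤ T.card ∧ s ∉ T

end LOCC

/-! ### The ensemble -/

/-- `|0⟩`. -/
def ketZero : Fin 2 → ℂ := ![1, 0]

/-- `|θ⟩ = cos θ |0⟩ + sin θ |1⟩`. -/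
noncomputable def ketAngle (θ : ℝ) : Fin 2 → ℂ := ![(Real.cos θ : ℂ), (Real.sin θ : ℂ)]

/-- The three-qubit states `|0⟩|0⟩|0⟩`, `|0⟩|θ⟩|θ⟩`, `|θ⟩|0⟩|θ⟩`. -/
noncomputable def stateNL2 (θ : ℝ) : Fin 3 → (Fin 3 → Fin 2) → ℂ :=
  ![productState ![ketZero, ketZero, ketZero],
    productState ![ketZero, ketAngle θ, ketAngle θ],
    productState ![ketAngle θ, ketZero, ketAngle θ]]

end Antimarking

/-! Global part: any two of the three states have overlap cos²θ ≤ 1/2, so the triple is isometric to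
(0,a,b), (b,0,a), (a,b,0) with ab = cos²θ, and a basis measurement excludes one state
(`antidistinguishable_of_gram`). Pairs are handled by measuring the first system alone.

Conclusive part: each party holds one vector in two of the states and another in the third. An
outcome orthogonal to the majority vector identifies that third state (`conclusiveBasesNL2`); using
these bases on every copy gives CLSM.

Impossibility: on pairs, each party holds (v,v), (v',v) or (v,v'), with overlaps c, c, c², where c =
cos θ. For 1/3 < c² < 1 no measurement always excludes one of them (`not_canExclude_of_gram`). If
every branch of a local measurement allowed exclusion, the measurement followed by the branch
exclusions would exclude too, so some branch preserves non-excludability. Following such branches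
leads to an output possible for all six pairs (`LOCC.exists_forall_prob_pos`); it can exclude none
of them. -/

namespace Antimarking

/-! ### Product vectors under local operations, ancillas and copies. -/

section ProductStates

variable {P : Type} [Fintype P]

/-- Every branch of a protocol run on a product input therefore stays a product, and each party can
be followed separately. -/
theorem applyLocal_productState [DecidableEq P] {D : P → Type} [∀ p, Fintype (D p)] (p : P)
    (K : Matrix (D p) (D p) ℂ) (v : ∀ p, D p → ℂ) :
    applyLocal p K (productState v) = productState (Function.update v p (K.mulVec (v p))) := by
  funext x
  simp only [applyLocal, productState]
  rw [← Finset.mul_prod_erase _ _ (Finset.mem_univ p)]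
  simp only [Function.update_self, Matrix.mulVec, dotProduct, Finset.sum_mul]
  refine Finset.sum_congr rfl fun a _ => ?_
  rw [← Finset.mul_prod_erase _ _ (Finset.mem_univ p), Function.update_self, mul_assoc]
  congr 2
  refine Finset.prod_congr rfl fun q hq => ?_
  have hq' := Finset.ne_of_mem_erase hq
  rw [Function.update_of_ne hq', Function.update_of_ne hq']

theorem sum_norm_sq_productState [DecidableEq P] {D : P → Type} [∀ p, Fintype (D p)]
    (v : ∀ p, D p → ℂ) :
    ∑ x, ‖productState v x‖ ^ 2 = ∏ p, ∑ y, ‖v p y‖ ^ 2 := by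
  rw [Finset.prod_univ_sum, Fintype.piFinset_univ]
  simp only [productState, norm_prod, Finset.prod_pow]

theorem sum_norm_sq_productState_pos [DecidableEq P] {D : P → Type} [∀ p, Fintype (D p)]
    {v : ∀ p, D p → ℂ}
    (hv : ∀ p, v p ≠ 0) : 0 < ∑ x, ‖productState v x‖ ^ 2 := by
  rw [sum_norm_sq_productState]
  refine Finset.prod_pos fun p _ => ?_
  obtain ⟨y, hy⟩ := Function.ne_iff.mp (hv p)
  exact Finset.sum_pos' (fun _ _ => by positivity)
    ⟨y, Finset.mem_univ _, by have := norm_pos_iff.mpr hy; positivity⟩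

/-- A local vector with the local ancilla in the state `|0⟩`. -/
def attachLocal {d : Type} (a : ℕ) (v : d → ℂ) : d × Fin (a + 1) → ℂ :=
  fun x => if x.2 = 0 then v x.1 else 0

theorem attachAncilla_productState {D : P → Type} (a : P → ℕ) (v : ∀ p, D p → ℂ) :
    attachAncilla a (productState v) = productState fun p => attachLocal (a p) (v p) := by
  funext x
  simp only [attachAncilla, productState, attachLocal]
  split_ifs with h
  · exact Finset.prod_congr rfl fun p _ => by rw [if_pos (h p)]
  · push Not at h
    obtain ⟨p, hp⟩ := h
    exact (Finset.prod_eq_zero (Finset.mem_univ p) (by rw [if_neg hp])).symm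

theorem star_attachLocal_dotProduct {d : Type} [Fintype d] (a : ℕ) (v w : d → ℂ) :
    star (attachLocal a v) ⬝ᵥ attachLocal a w = star v ⬝ᵥ w := by
  simp [dotProduct, Fintype.sum_prod_type, attachLocal]

/-- The product vector `⊗ₖ v k` of several systems of the same kind. -/
def tensorVec {d : Type} {n : ℕ} (v : Fin n → d → ℂ) : (Fin n → d) → ℂ :=
  fun y => ∏ k, v k (y k)

theorem star_tensorVec_dotProduct {d : Type} [Fintype d] {n : ℕ} (v w : Fin n → d → ℂ) :
    star (tensorVec v) ⬝ᵥ tensorVec w = ∏ k, star (v k) ⬝ᵥ w k := by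
  simp only [dotProduct, Finset.prod_univ_sum, Fintype.piFinset_univ, tensorVec, Pi.star_apply,
    star_prod, Finset.prod_mul_distrib]

theorem seqState_productState {D : P → Type} {ι : Type} (n : ℕ) (v : ι → ∀ p, D p → ℂ)
    (s : Fin n ↪ ι) :
    seqState n (fun i => productState (v i)) s
      = productState (D := fun p => Fin n → D p) fun p => tensorVec fun k => v (s k) p := by
  funext x
  simp only [seqState, productState, tensorVec]
  exact Finset.prod_comm

theorem LOCC.prob_nonneg [DecidableEq P] {D : P → Type} [∀ p, Fintype (D p)]
    [∀ p, DecidableEq (D p)] {O : Type} [DecidableEq O] (o : O) (L : LOCC D O) (ψ : (∀ p, D p) → ℂ) : 0 ≤ L.prob o ψ := by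
  induction L generalizing ψ with
  | output o' => simp only [LOCC.prob]; split_ifs <;> positivity
  | measure p r K _ next ih =>
    simp only [LOCC.prob]
    exact Finset.sum_nonneg fun i _ => ih i _

end ProductStates

/-! ### The local vectors of the ensemble and their overlaps. -/

/-- The local vectors of the three states. -/
noncomputable def localNL2 (θ : ℝ) : Fin 3 → Fin 3 → Fin 2 → ℂ :=
  ![![ketZero, ketZero, ketZero], ![ketZero, ketAngle θ, ketAngle θ],
    ![ketAngle θ, ketZero, ketAngle θ]]

theorem stateNL2_eq (θ : ℝ) : stateNL2 θ = fun i => productState (localNL2 θ i) := by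
  funext i
  fin_cases i <;> rfl

theorem star_ketZero_dotProduct_self : star ketZero ⬝ᵥ ketZero = 1 := by
  simp [ketZero, dotProduct, Fin.sum_univ_two]

theorem star_ketAngle_dotProduct_self (θ : ℝ) : star (ketAngle θ) ⬝ᵥ ketAngle θ = 1 := by
  simp only [ketAngle, dotProduct, Fin.sum_univ_two, Pi.star_apply, Matrix.cons_val_zero,
    Matrix.cons_val_one, RCLike.star_def, Complex.conj_ofReal]
  norm_cast
  nlinarith [Real.sin_sq_add_cos_sq θ]

theorem star_ketZero_dotProduct_ketAngle (θ : ℝ) :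
    star ketZero ⬝ᵥ ketAngle θ = (Real.cos θ : ℂ) := by
  simp [ketZero, ketAngle, dotProduct, Fin.sum_univ_two]

theorem star_ketAngle_dotProduct_ketZero (θ : ℝ) :
    star (ketAngle θ) ⬝ᵥ ketZero = (Real.cos θ : ℂ) := by
  simp [ketZero, ketAngle, dotProduct, Fin.sum_univ_two, -Complex.ofReal_cos]

/-! ### Exclusion of one of three vectors -/

/-- Some measurement always excludes one of the three (unnormalized) vectors. -/
def CanExclude {d : Type} [Fintype d] [DecidableEq d] (w : Fin 3 → d → ℂ) : Prop :=
  ∃ M : POVM (Fin 3) d, ∀ j, (M.effect j).mulVec (w j) = 0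

/-- Always announcing `j` works. In contrapositive form, non-excludable vectors are nonzero, which
gives positive probability at a leaf. -/
theorem canExclude_of_eq_zero {d : Type} [Fintype d] [DecidableEq d] {w : Fin 3 → d → ℂ}
    {j : Fin 3} (hj : w j = 0) : CanExclude w := by
  refine ⟨⟨fun i => if i = j then 1 else 0, fun i => ?_, by simp⟩, fun i => ?_⟩
  · split_ifs
    exacts [.one, .zero]
  · dsimp only
    split_ifs with h
    · rw [h, hj, Matrix.mulVec_zero]
    · exact Matrix.zero_mulVec _

/-- Measuring `K` and then excluding in the branch obtained is a single measurement, with effects `∑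
i, (K i)ᴴ * (M i).effect j * K i`. -/
theorem canExclude_of_forall_branch {d : Type} [Fintype d] [DecidableEq d] {w : Fin 3 → d → ℂ}
    {r : ℕ} (K : Fin r → Matrix d d ℂ) (complete : ∑ i, (K i).conjTranspose * K i = 1)
    (h : ∀ i, CanExclude fun j => (K i).mulVec (w j)) : CanExclude w := by
  choose M hM using h
  refine ⟨⟨fun j => ∑ i, (K i).conjTranspose * (M i).effect j * K i, fun j => ?_, ?_⟩, fun j => ?_⟩
  · exact Matrix.posSemidef_sum _ fun i _ => ((M i).posSemidef j).conjTranspose_mul_mul_same (K i)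
  · rw [Finset.sum_comm, ← complete]
    refine Finset.sum_congr rfl fun i _ => ?_
    rw [← Finset.sum_mul, ← Finset.mul_sum, (M i).sum_effect, mul_one]
  · rw [Matrix.sum_mulVec]
    refine Finset.sum_eq_zero fun i _ => ?_
    rw [← Matrix.mulVec_mulVec, ← Matrix.mulVec_mulVec, hM i j, Matrix.mulVec_zero]

/-- This is the nonnegativity of the 2×2 principal minor on `i`, `k`. -/
theorem normSq_apply_le_of_posSemidef {n : Type} [Fintype n] {M : Matrix n n ℂ}
    (hM : M.PosSemidef) (i k : n) : Complex.normSq (M i k) ≤ (M i i).re * (M k k).re := by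
  have hdet := (hM.submatrix ![i, k]).det_nonneg
  have him : ∀ j, (M j j).im = 0 := fun j => (Complex.le_def.mp (hM.diag_nonneg (i := j))).2.symm
  have hki : M k i = star (M i k) := (hM.isHermitian.apply k i).symm
  rw [Matrix.det_fin_two] at hdet
  simp only [Matrix.submatrix_apply, Matrix.cons_val_zero, Matrix.cons_val_one, hki] at hdet
  have := (Complex.le_def.mp hdet).1
  simp only [Complex.zero_re, Complex.sub_re, Complex.mul_re, him, RCLike.star_def, Complex.conj_re,
    Complex.conj_im] at this
  rw [Complex.normSq_apply]
  linarith

/-- The first two bounds give p(1-q) ≤ p-y and (1-p)(1-r) ≤ 1-p-y. Multiplying and using the third,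
p(1-p)y² ≤ (p-y)(1-p-y), that is, y(1-y) ≤ p(1-p)(1-y²). Cancelling 1-y > 0 and using p(1-p) ≤ 1/4
leaves y ≤ (1+y)/4. -/
theorem le_third_of_weights {y p q r : ℝ} (hy : 0 < y) (hy1 : y < 1) (hp : 0 ≤ p) (hp1 : p ≤ 1)
    (hq1 : q ≤ 1) (hr1 : r ≤ 1) (h₁ : y ≤ p * q) (h₂ : y ≤ (1 - p) * r)
    (h₃ : y ^ 2 ≤ (1 - q) * (1 - r)) : y ≤ 1 / 3 := by
  have e : (p * (1 - q)) * ((1 - p) * (1 - r)) ≤ (p - y) * (1 - p - y) :=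
    mul_le_mul (by linarith) (by linarith)
      (mul_nonneg (by linarith) (by linarith)) (by nlinarith)
  have e₂ : p * (1 - p) * y ^ 2 ≤ p * (1 - p) * ((1 - q) * (1 - r)) :=
    mul_le_mul_of_nonneg_left h₃ (mul_nonneg hp (by linarith))
  have e₃ : (1 - y) * y ≤ (1 - y) * (p * (1 - p) * (1 + y)) := by nlinarith
  have e₄ := le_of_mul_le_mul_left e₃ (by linarith)
  nlinarith [sq_nonneg (2 * p - 1)]

/-- Compressing the effects to the three vectors splits their Gram matrix into positive semidefinite
`N j` whose row and column `j` vanish. The 2×2 minors of the `N j` then bound the overlaps by the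
diagonal weights. -/
theorem not_canExclude_of_gram {d : Type} [Fintype d] [DecidableEq d] {w : Fin 3 → d → ℂ} {c : ℝ}
    (hc : 1 / 3 < c ^ 2) (hc1 : c ^ 2 < 1) (hself : ∀ j, star (w j) ⬝ᵥ w j = 1)
    (h₁ : star (w 0) ⬝ᵥ w 1 = (c : ℂ)) (h₂ : star (w 0) ⬝ᵥ w 2 = (c : ℂ))
    (h₁₂ : star (w 1) ⬝ᵥ w 2 = (c : ℂ) ^ 2) : ¬ CanExclude w := by
  rintro ⟨M, hM⟩
  set W : Matrix d (Fin 3) ℂ := Matrix.of fun y j => w j y with hW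
  set N : Fin 3 → Matrix (Fin 3) (Fin 3) ℂ := fun j => W.conjTranspose * M.effect j * W with hN
  have hpos : ∀ j, (N j).PosSemidef := fun j => (M.posSemidef j).conjTranspose_mul_mul_same W
  have hsum : ∀ i k, N 0 i k + N 1 i k + N 2 i k = star (w i) ⬝ᵥ w k := by
    intro i k
    have : ∑ j, N j = W.conjTranspose * W := by
      simp only [hN]
      rw [← Matrix.sum_mul, ← Matrix.mul_sum, M.sum_effect, Matrix.mul_one]
    rw [Fin.sum_univ_three] at this
    exact congrFun (congrFun this i) k
  have hcol : ∀ i j, N j i j = 0 := by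
    intro i j
    have : N j i j = W.conjTranspose.mulVec ((M.effect j).mulVec (w j)) i := by
      rw [Matrix.mulVec_mulVec]; rfl
    rw [this, hM j, Matrix.mulVec_zero, Pi.zero_apply]
  have hrow : ∀ i j, N j j i = 0 := fun i j => by
    rw [← (hpos j).isHermitian.apply, hcol, star_zero]
  have hre : ∀ i, (N 0 i i).re + (N 1 i i).re + (N 2 i i).re = 1 := fun i => by
    rw [← Complex.add_re, ← Complex.add_re, hsum, hself, Complex.one_re]
  have hnn : ∀ j i, 0 ≤ (N j i i).re := fun j i =>
    (Complex.le_def.mp ((hpos j).diag_nonneg (i := i))).1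
  -- Only the effect indexed by the third index contributes to an off-diagonal Gram entry.
  have e01 : N 2 0 1 = c := by simpa [hrow, hcol, h₁] using hsum 0 1
  have e02 : N 1 0 2 = c := by simpa [hrow, hcol, h₂] using hsum 0 2
  have e12 : N 0 1 2 = (c : ℂ) ^ 2 := by simpa [hrow, hcol, h₁₂] using hsum 1 2
  have k01 := normSq_apply_le_of_posSemidef (hpos 2) 0 1
  have k02 := normSq_apply_le_of_posSemidef (hpos 1) 0 2
  have k12 := normSq_apply_le_of_posSemidef (hpos 0) 1 2
  rw [e01, Complex.normSq_ofReal] at k01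
  rw [e02, Complex.normSq_ofReal] at k02
  rw [e12, ← Complex.ofReal_pow, Complex.normSq_ofReal] at k12
  have d0 := hre 0
  have d1 := hre 1
  have d2 := hre 2
  rw [hrow, Complex.zero_re] at d0 d1 d2
  -- Each diagonal entry 1 of the Gram matrix is shared by just two effects, so three weights p, q,
  -- r describe the whole diagonal.
  have a0 : (N 1 0 0).re = 1 - (N 2 0 0).re := by linarith
  have a1 : (N 0 1 1).re = 1 - (N 2 1 1).re := by linarith
  have a2 : (N 0 2 2).re = 1 - (N 1 2 2).re := by linarith
  rw [a0] at k02
  rw [a1, a2] at k12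
  have := le_third_of_weights (y := c ^ 2) (q := (N 2 1 1).re) (r := (N 1 2 2).re)
    (by linarith) hc1 (hnn 2 0) (by linarith [hnn 1 0])
    (by linarith [hnn 0 1]) (by linarith [hnn 0 2]) (by linarith [k01]) (by linarith [k02])
    (by linarith [k12])
  linarith

/-! ### LOCC protocols cannot create local exclusion -/

/-- If no party can exclude one of its local vectors, then some output of an LOCC protocol occurs
with positive probability for all the product states formed of these vectors. -/
theorem LOCC.exists_forall_prob_pos {P : Type} [Fintype P] [DecidableEq P] {D : P → Type}
    [∀ p, Fintype (D p)] [∀ p, DecidableEq (D p)] {O : Type} [DecidableEq O] {ι : Type}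
    (g : P → ι → Fin 3) (L : LOCC D O) (w : ∀ p, Fin 3 → D p → ℂ) (hw : ∀ p, ¬ CanExclude (w p)) :
    ∃ o, ∀ s, 0 < L.prob o (productState fun p => w p (g p s)) := by
  induction L generalizing w with
  | output o =>
    refine ⟨o, fun s => ?_⟩
    rw [LOCC.prob, if_pos rfl]
    exact sum_norm_sq_productState_pos fun p h0 => hw p (canExclude_of_eq_zero h0)
  | measure p r K complete next ih =>
    -- The branch depends on the local vectors of party `p` only, not on the input `s`, so one path
    -- serves all inputs.
    obtain ⟨i, hi⟩ : ∃ i, ¬ CanExclude fun j => (K i).mulVec (w p j) := by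
      by_contra! h
      exact hw p (canExclude_of_forall_branch K complete h)
    obtain ⟨o, ho⟩ := ih i (Function.update w p fun j => (K i).mulVec (w p j)) fun q => by
      by_cases hq : q = p
      · subst hq
        rwa [Function.update_self]
      · rw [Function.update_of_ne hq]
        exact hw q
    refine ⟨o, fun s => ?_⟩
    rw [LOCC.prob]
    refine Finset.sum_pos' (fun _ _ => LOCC.prob_nonneg _ _ _) ⟨i, Finset.mem_univ _, ?_⟩
    have hupd : (Function.update (fun q => w q (g q s)) p ((K i).mulVec (w p (g p s)))) =
        fun q => Function.update w p (fun j => (K i).mulVec (w p j)) q (g q s) := by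
      funext q
      by_cases hq : q = p
      · subst hq
        simp only [Function.update_self]
      · simp only [Function.update_of_ne hq]
    rw [applyLocal_productState, hupd]
    exact ho s

/-! ### Antimarking pairs of the ensemble -/

/-- The pair `(v, v)`, `(v', v)` or `(v, v')`. -/
def pairVec {d : Type} (v v' : d → ℂ) : Fin 3 → (Fin 2 → d) → ℂ :=
  ![tensorVec ![v, v], tensorVec ![v', v], tensorVec ![v, v']]

/-- Here (v,v) has overlap c with each of the other two pairs, which overlap in c·c; an ancilla in
|0⟩ leaves overlaps unchanged. -/
theorem not_canExclude_attachLocal_pairVec {d : Type} [Fintype d] [DecidableEq d] {v v' : d → ℂ}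
    {c : ℝ} (hc : 1 / 3 < c ^ 2) (hc1 : c ^ 2 < 1) (hv : star v ⬝ᵥ v = 1) (hv' : star v' ⬝ᵥ v' = 1)
    (h : star v ⬝ᵥ v' = (c : ℂ)) (h' : star v' ⬝ᵥ v = (c : ℂ)) (a : ℕ) :
    ¬ CanExclude fun j => attachLocal a (pairVec v v' j) := by
  apply not_canExclude_of_gram hc hc1
  · intro j
    rw [star_attachLocal_dotProduct]
    fin_cases j <;> simp [pairVec, star_tensorVec_dotProduct, Fin.prod_univ_two, hv, hv']
  all_goals
    rw [star_attachLocal_dotProduct]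
    simp [pairVec, star_tensorVec_dotProduct, Fin.prod_univ_two, hv, h, h', pow_two]

/-- The vector that party `p` holds in two of the three states. -/
noncomputable def majorityNL2 (θ : ℝ) : Fin 3 → Fin 2 → ℂ := ![ketZero, ketZero, ketAngle θ]

/-- The vector of party `p` in the state in which it differs from the other two. -/
noncomputable def minorityNL2 (θ : ℝ) : Fin 3 → Fin 2 → ℂ := ![ketAngle θ, ketAngle θ, ketZero]

/-- The position, in a pair of states, of the state in which party `p` holds the minority
vector. -/
def minorityPosition (p : Fin 3) (s : Fin 2 ↪ Fin 3) : Fin 3 :=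
  -- The values index `pairVec`; 0 covers the pairs that omit state `p.rev`, where the party holds
  -- its majority vector twice.
  if s 0 = p.rev then 1 else if s 1 = p.rev then 2 else 0

theorem localNL2_eq (θ : ℝ) (i p : Fin 3) :
    localNL2 θ i p = if i = p.rev then minorityNL2 θ p else majorityNL2 θ p := by
  fin_cases i <;> fin_cases p <;> rfl

theorem tensorVec_localNL2 (θ : ℝ) (s : Fin 2 ↪ Fin 3) (p : Fin 3) :
    (tensorVec fun k => localNL2 θ (s k) p)
      = pairVec (majorityNL2 θ p) (minorityNL2 θ p) (minorityPosition p s) := by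
  have hne : s 0 ≠ s 1 := fun h => absurd (s.injective h) (by decide)
  funext y
  simp only [tensorVec, Fin.prod_univ_two, localNL2_eq, minorityPosition]
  split_ifs with h0 h1 h1
  · exact absurd (h0.trans h1.symm) hne
  all_goals simp [pairVec, tensorVec, Fin.prod_univ_two]

theorem not_admitsLSAM_two_one {θ : ℝ} (hc : 1 / 3 < Real.cos θ ^ 2) (hc1 : Real.cos θ ^ 2 < 1) :
    ¬ AdmitsLSAM 2 1 (stateNL2 θ) := by
  rintro ⟨a, L, hL⟩
  obtain ⟨T, hT⟩ := L.exists_forall_prob_pos minorityPosition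
    (fun p j => attachLocal (a p) (pairVec (majorityNL2 θ p) (minorityNL2 θ p) j)) fun p => by
      apply not_canExclude_attachLocal_pairVec hc hc1 <;> fin_cases p <;>
      first
      | exact star_ketZero_dotProduct_self
      | exact star_ketAngle_dotProduct_self θ
      | exact star_ketZero_dotProduct_ketAngle θ
      | exact star_ketAngle_dotProduct_ketZero θ
  have key : ∀ s, 1 ≤ T.card ∧ s ∉ T := fun s => by
    refine hL s T ?_
    rw [stateNL2_eq, seqState_productState, attachAncilla_productState]
    simp only [tensorVec_localNL2]
    exact (hT s).ne'
  -- Any sequence serves to show that `T` is nonempty.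
  obtain ⟨s, hs⟩ := Finset.card_pos.mp (key (Fin.castLEEmb (by decide))).1
  exact (key s).2 hs

/-! ### Conclusive discrimination by local projective measurements -/

/-- The Kraus operators of the measurement in the basis formed by the conjugated rows of `U`. -/
noncomputable def basisKraus {d : Type} [Fintype d] [DecidableEq d] (U : Matrix d d ℂ)
    (i : Fin (Fintype.card d)) : Matrix d d ℂ :=
  Matrix.single ((Fintype.equivFin d).symm i) ((Fintype.equivFin d).symm i) 1 * U

theorem sum_basisKraus {d : Type} [Fintype d] [DecidableEq d] {U : Matrix d d ℂ}
    (hU : U.conjTranspose * U = 1) :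
    ∑ i, (basisKraus U i).conjTranspose * basisKraus U i = 1 := by
  have h : ∀ i, (basisKraus U i).conjTranspose * basisKraus U i = U.conjTranspose *
      (Matrix.single ((Fintype.equivFin d).symm i) ((Fintype.equivFin d).symm i) 1 * U) :=
    fun i => by
    rw [basisKraus, Matrix.conjTranspose_mul, Matrix.conjTranspose_single, Matrix.mul_assoc,
      ← Matrix.mul_assoc (Matrix.single _ _ _) (Matrix.single _ _ _), Matrix.single_mul_single_same,
      star_one, mul_one]
  simp only [h]
  rw [← Matrix.mul_sum, ← Matrix.sum_mul,
    Equiv.sum_comp (Fintype.equivFin d).symm fun x => Matrix.single x x (1 : ℂ),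
    Matrix.sum_single_one, Matrix.one_mul, hU]

theorem sum_norm_sq_basisKraus {d : Type} [Fintype d] [DecidableEq d] (U : Matrix d d ℂ)
    (i : Fin (Fintype.card d)) (v : d → ℂ) :
    ∑ y, ‖(basisKraus U i).mulVec v y‖ ^ 2 = ‖U.mulVec v ((Fintype.equivFin d).symm i)‖ ^ 2 := by
  rw [basisKraus, ← Matrix.mulVec_mulVec, Matrix.single_mulVec,
    Finset.sum_eq_single ((Fintype.equivFin d).symm i)]
  · simp
  · intro y _ hy
    simp [hy]
  · simp

/-- Each of three parties measures in a basis, and the output depends on the three outcomes. -/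
noncomputable def basisProtocol {d O : Type} [Fintype d] [DecidableEq d]
    (U : Fin 3 → Matrix d d ℂ) (hU : ∀ p, (U p).conjTranspose * U p = 1) (f : (Fin 3 → d) → O) :
    LOCC (fun _ : Fin 3 => d) O :=
  .measure 0 _ (basisKraus (U 0)) (sum_basisKraus (hU 0)) fun i =>
  .measure 1 _ (basisKraus (U 1)) (sum_basisKraus (hU 1)) fun j =>
  .measure 2 _ (basisKraus (U 2)) (sum_basisKraus (hU 2)) fun k =>
  .output (f ![(Fintype.equivFin d).symm i, (Fintype.equivFin d).symm j,
    (Fintype.equivFin d).symm k])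

theorem prob_basisProtocol {d O : Type} [Fintype d] [DecidableEq d] [DecidableEq O]
    (U : Fin 3 → Matrix d d ℂ) (hU : ∀ p, (U p).conjTranspose * U p = 1) (f : (Fin 3 → d) → O)
    (o : O) (v : Fin 3 → d → ℂ) :
    (basisProtocol U hU f).prob o (productState v) =
      ∑ x, ∑ y, ∑ z, if f ![x, y, z] = o then
        ∏ p, ‖(U p).mulVec (v p) ((![x, y, z] : Fin 3 → d) p)‖ ^ 2 else 0 := by
  simp only [basisProtocol, LOCC.prob, applyLocal_productState, sum_norm_sq_productState]
  rw [← Equiv.sum_comp (Fintype.equivFin d).symm]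
  refine Finset.sum_congr rfl fun i _ => ?_
  rw [← Equiv.sum_comp (Fintype.equivFin d).symm]
  refine Finset.sum_congr rfl fun j _ => ?_
  rw [← Equiv.sum_comp (Fintype.equivFin d).symm]
  refine Finset.sum_congr rfl fun k _ => ?_
  congr 1
  simp only [Fin.prod_univ_three, ← sum_norm_sq_basisKraus, Matrix.cons_val_zero,
    Matrix.cons_val_one, Matrix.cons_val]
  rfl

theorem exists_eq_vec_three {d : Type} (x : Fin 3 → d) : ∃ a b c, x = ![a, b, c] :=
  ⟨x 0, x 1, x 2, by funext i; fin_cases i <;> rfl⟩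

theorem prob_basisProtocol_eq_zero {d O : Type} [Fintype d] [DecidableEq d] [DecidableEq O]
    {U : Fin 3 → Matrix d d ℂ} (hU : ∀ p, (U p).conjTranspose * U p = 1) {f : (Fin 3 → d) → O}
    {o : O} {v : Fin 3 → d → ℂ} (h : ∀ x, f x = o → ∃ p, (U p).mulVec (v p) (x p) = 0) :
    (basisProtocol U hU f).prob o (productState v) = 0 := by
  rw [prob_basisProtocol]
  refine Finset.sum_eq_zero fun x _ => Finset.sum_eq_zero fun y _ =>
    Finset.sum_eq_zero fun z _ => ?_
  split_ifs with hf
  · obtain ⟨p, hp⟩ := h _ hf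
    exact Finset.prod_eq_zero (Finset.mem_univ p) (by rw [hp]; simp)
  · rfl

theorem prob_basisProtocol_pos {d O : Type} [Fintype d] [DecidableEq d] [DecidableEq O]
    {U : Fin 3 → Matrix d d ℂ} (hU : ∀ p, (U p).conjTranspose * U p = 1) {f : (Fin 3 → d) → O}
    {o : O} {v : Fin 3 → d → ℂ} {x : Fin 3 → d} (hx : f x = o)
    (h : ∀ p, (U p).mulVec (v p) (x p) ≠ 0) :
    0 < (basisProtocol U hU f).prob o (productState v) := by
  rw [prob_basisProtocol]
  have hn : ∀ x y z, 0 ≤ if f ![x, y, z] = o then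
      ∏ p, ‖(U p).mulVec (v p) ((![x, y, z] : Fin 3 → d) p)‖ ^ 2 else 0 := fun x y z => by
    split_ifs <;> positivity
  obtain ⟨a, b, c, rfl⟩ := exists_eq_vec_three x
  refine Finset.sum_pos' (fun _ _ => Finset.sum_nonneg fun _ _ => Finset.sum_nonneg fun _ _ =>
    hn _ _ _) ⟨a, Finset.mem_univ _, ?_⟩
  refine Finset.sum_pos' (fun _ _ => Finset.sum_nonneg fun _ _ => hn _ _ _)
    ⟨b, Finset.mem_univ _, ?_⟩
  refine Finset.sum_pos' (fun _ _ => hn _ _ _) ⟨c, Finset.mem_univ _, ?_⟩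
  rw [if_pos hx]
  exact Finset.prod_pos fun p _ => pow_pos (norm_pos_iff.mpr (h p)) 2

/-- Local measurements in the bases `U p` followed by the decision `f` conclusively identify the
product states `⊗ₚ v i p`. -/
structure ConclusiveBases {d ι : Type} [Fintype d] [DecidableEq d] (v : ι → Fin 3 → d → ℂ)
    (U : Fin 3 → Matrix d d ℂ) (f : (Fin 3 → d) → Option ι) : Prop where
  isometry : ∀ p, (U p).conjTranspose * U p = 1
  eq_of_amplitude : ∀ i j x, f x = some j → (∀ p, (U p).mulVec (v i p) (x p) ≠ 0) → i = j
  exists_amplitude : ∀ i, ∃ x, f x = some i ∧ ∀ p, (U p).mulVec (v i p) (x p) ≠ 0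

/-- No ancilla is needed, but choosing `a = 0` still leaves a factor `Fin (0 + 1)`; pulling `U` back
along the first projection absorbs it. -/
theorem submatrix_fst_mulVec_attachLocal {d : Type} [Fintype d] (U : Matrix d d ℂ) (v : d → ℂ)
    (x : d × Fin (0 + 1)) :
    (U.submatrix Prod.fst Prod.fst).mulVec (attachLocal 0 v) x = U.mulVec v x.1 := by
  simp [Matrix.mulVec, dotProduct, Fintype.sum_prod_type, attachLocal, Fin.eq_zero]

theorem conjTranspose_submatrix_fst_mul_self {d : Type} [Fintype d] [DecidableEq d]
    {U : Matrix d d ℂ} (hU : U.conjTranspose * U = 1) :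
    (U.submatrix (Prod.fst : d × Fin (0 + 1) → d)
      (Prod.fst : d × Fin (0 + 1) → d)).conjTranspose *
      U.submatrix (Prod.fst : d × Fin (0 + 1) → d) (Prod.fst : d × Fin (0 + 1) → d) = 1 := by
  have h := Matrix.submatrix_mul_equiv U.conjTranspose U (Prod.fst : d × Fin (0 + 1) → d)
    (Equiv.prodUnique d (Fin 1)) (Prod.fst : d × Fin (0 + 1) → d)
  rw [hU] at h
  rw [Matrix.conjTranspose_submatrix]
  exact h.trans (Matrix.submatrix_one_equiv (Equiv.prodUnique d (Fin 1)))

theorem ConclusiveBases.admitsCLSD {d ι : Type} [Fintype d] [DecidableEq d] [DecidableEq ι]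
    {v : ι → Fin 3 → d → ℂ} {U : Fin 3 → Matrix d d ℂ} {f : (Fin 3 → d) → Option ι}
    (h : ConclusiveBases v U f) :
    AdmitsCLSD (D := fun _ : Fin 3 => d) fun i => productState (v i) := by
  refine ⟨fun _ => 0, basisProtocol (d := d × Fin (0 + 1))
    (fun p => (U p).submatrix Prod.fst Prod.fst)
    (fun p => conjTranspose_submatrix_fst_mul_self (h.isometry p))
    (fun x => f fun p => (x p).1), fun i j hij => ?_, fun i => ?_⟩
  · rw [attachAncilla_productState]
    refine prob_basisProtocol_eq_zero (d := d × Fin (0 + 1)) _ fun x hx => ?_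
    by_contra! hne
    refine hij (h.eq_of_amplitude i j _ hx fun p => ?_)
    rw [← submatrix_fst_mulVec_attachLocal]
    exact hne p
  · rw [attachAncilla_productState]
    obtain ⟨x, hx, hne⟩ := h.exists_amplitude i
    refine prob_basisProtocol_pos (d := d × Fin (0 + 1)) _ (x := fun p => (x p, 0)) hx fun p => ?_
    rw [submatrix_fst_mulVec_attachLocal]
    exact hne p

/-- The tensor power of a matrix. -/
def tensorPow {d : Type} (n : ℕ) (U : Matrix d d ℂ) : Matrix (Fin n → d) (Fin n → d) ℂ :=
  Matrix.of fun x y => ∏ k, U (x k) (y k)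

theorem tensorPow_mulVec {d : Type} [Fintype d] (n : ℕ) (U : Matrix d d ℂ) (v : Fin n → d → ℂ)
    (x : Fin n → d) : (tensorPow n U).mulVec (tensorVec v) x = ∏ k, U.mulVec (v k) (x k) := by
  simp only [Matrix.mulVec, dotProduct, Finset.prod_univ_sum, Fintype.piFinset_univ, tensorVec,
    tensorPow, Matrix.of_apply, Finset.prod_mul_distrib]

theorem conjTranspose_tensorPow_mul_self {d : Type} [Fintype d] [DecidableEq d] (n : ℕ)
    {U : Matrix d d ℂ} (hU : U.conjTranspose * U = 1) :
    (tensorPow n U).conjTranspose * tensorPow n U = 1 := by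
  ext x y
  have h : ((tensorPow n U).conjTranspose * tensorPow n U) x y
      = ∏ k, (U.conjTranspose * U) (x k) (y k) := by
    simp only [Matrix.mul_apply, tensorPow, Matrix.of_apply, Matrix.conjTranspose_apply, star_prod,
      ← Finset.prod_mul_distrib]
    rw [Finset.prod_univ_sum, Fintype.piFinset_univ]
  rw [h, hU]
  by_cases hxy : x = y
  · subst hxy
    simp only [Matrix.one_apply_eq, Finset.prod_const_one]
  · obtain ⟨k, hk⟩ := Function.ne_iff.mp hxy
    rw [Matrix.one_apply_ne hxy]
    exact Finset.prod_eq_zero (Finset.mem_univ k) (Matrix.one_apply_ne hk)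

open Classical in
/-- Applies the decision `f` to each of `n` systems, and answers if this yields a sequence of
distinct indices. -/
noncomputable def decideSequence {d ι : Type} (n : ℕ) (f : (Fin 3 → d) → Option ι)
    (x : Fin 3 → Fin n → d) : Option (Fin n ↪ ι) :=
  if h : ∃ s : Fin n ↪ ι, ∀ k, f (fun p => x p k) = some (s k) then some h.choose else none

theorem decideSequence_eq_some {d ι : Type} {n : ℕ} {f : (Fin 3 → d) → Option ι}
    {x : Fin 3 → Fin n → d} {s : Fin n ↪ ι} :
    decideSequence n f x = some s ↔ ∀ k, f (fun p => x p k) = some (s k) := by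
  unfold decideSequence
  constructor
  · intro hs
    split_ifs at hs with h
    rw [← Option.some.inj hs]
    exact h.choose_spec
  · intro hs
    have h : ∃ s : Fin n ↪ ι, ∀ k, f (fun p => x p k) = some (s k) := ⟨s, hs⟩
    rw [dif_pos h]
    congr 1
    ext k
    exact Option.some.inj ((h.choose_spec k).symm.trans (hs k))

/-- Amplitudes of tensor powers are products, nonzero exactly when every factor is, so the
conditions hold copy by copy. -/
theorem ConclusiveBases.tensorPow {d ι : Type} [Fintype d] [DecidableEq d]
    {v : ι → Fin 3 → d → ℂ} {U : Fin 3 → Matrix d d ℂ} {f : (Fin 3 → d) → Option ι}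
    (h : ConclusiveBases v U f) (n : ℕ) :
    ConclusiveBases (fun (s : Fin n ↪ ι) p => tensorVec fun k => v (s k) p)
      (fun p => Antimarking.tensorPow n (U p)) (decideSequence n f) where
  isometry p := conjTranspose_tensorPow_mul_self n (h.isometry p)
  eq_of_amplitude s t x hx hne := by
    rw [decideSequence_eq_some] at hx
    ext k
    refine h.eq_of_amplitude _ _ _ (hx k) fun p => ?_
    have := hne p
    rw [tensorPow_mulVec, Finset.prod_ne_zero_iff] at this
    exact this k (Finset.mem_univ k)
  exists_amplitude s := by
    choose x hx hne using fun k => h.exists_amplitude (s k)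
    refine ⟨fun p k => x k p, decideSequence_eq_some.mpr hx, fun p => ?_⟩
    rw [tensorPow_mulVec, Finset.prod_ne_zero_iff]
    exact fun k _ => hne k p

theorem ConclusiveBases.admitsCLSM {d ι : Type} [Fintype d] [DecidableEq d] [DecidableEq ι]
    {v : ι → Fin 3 → d → ℂ} {U : Fin 3 → Matrix d d ℂ} {f : (Fin 3 → d) → Option ι}
    (h : ConclusiveBases v U f) (n : ℕ) :
    AdmitsCLSM (D := fun _ : Fin 3 => d) n fun i => productState (v i) := by
  have := (h.tensorPow n).admitsCLSD
  unfold AdmitsCLSM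
  convert this using 1
  funext s
  exact seqState_productState n v s

/-- The first two parties measure in the standard basis, the third one in the basis
`|θ⟩, |θ + π/2⟩`. -/
noncomputable def basesNL2 (θ : ℝ) : Fin 3 → Matrix (Fin 2) (Fin 2) ℂ :=
  ![1, 1, !![(Real.cos θ : ℂ), (Real.sin θ : ℂ); -(Real.sin θ : ℂ), (Real.cos θ : ℂ)]]

/-- The state identified by the outcomes of the measurements in `basesNL2`. -/
def decideNL2 (x : Fin 3 → Fin 2) : Option (Fin 3) :=
  -- The order of the tests is immaterial: on state `i` only party `i.rev` can obtain outcome 1.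
  if x 0 = 1 then some 2 else if x 1 = 1 then some 1 else if x 2 = 1 then some 0 else none

/-- Outcome 1 is orthogonal to the majority vector: |1⟩ to |0⟩ for the first two parties, |θ + π/2⟩
to |θ⟩ for the third. -/
theorem eq_of_amplitudeNL2 {θ : ℝ} {i p : Fin 3}
    (h : (basesNL2 θ p).mulVec (localNL2 θ i p) 1 ≠ 0) : i = p.rev := by
  by_contra hne
  rw [localNL2_eq, if_neg hne] at h
  apply h
  fin_cases p
  · simp [basesNL2, majorityNL2, ketZero]
  · simp [basesNL2, majorityNL2, ketZero]
  · simp [basesNL2, majorityNL2, ketAngle, Matrix.mulVec, dotProduct, Fin.sum_univ_two]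
    ring

theorem conclusiveBasesNL2 {θ : ℝ} (hs : Real.sin θ ≠ 0) :
    ConclusiveBases (localNL2 θ) (basesNL2 θ) decideNL2 where
  isometry p := by
    have h : (Real.cos θ : ℂ) * Real.cos θ + Real.sin θ * Real.sin θ = 1 := by
      norm_cast
      nlinarith [Real.sin_sq_add_cos_sq θ]
    fin_cases p
    · simp [basesNL2]
    · simp [basesNL2]
    · ext i j
      fin_cases i <;> fin_cases j <;>
        simp [basesNL2, Matrix.mul_apply, Fin.sum_univ_two, -Complex.ofReal_cos,
          -Complex.ofReal_sin] <;> grind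
  eq_of_amplitude i j x hx hne := by
    unfold decideNL2 at hx
    split_ifs at hx with h0 h1 h2
    · rw [← Option.some.inj hx]
      exact eq_of_amplitudeNL2 (h0 ▸ hne 0)
    · rw [← Option.some.inj hx]
      exact eq_of_amplitudeNL2 (h1 ▸ hne 1)
    · rw [← Option.some.inj hx]
      exact eq_of_amplitudeNL2 (h2 ▸ hne 2)
  exists_amplitude i := by
    have hs' : (Real.sin θ : ℂ) ≠ 0 := Complex.ofReal_ne_zero.mpr hs
    have h : (Real.cos θ : ℂ) * Real.cos θ + Real.sin θ * Real.sin θ ≠ 0 := by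
      norm_cast
      nlinarith [Real.sin_sq_add_cos_sq θ]
    -- Only the party holding the minority vector obtains 1, with amplitude ± sin θ; the others
    -- obtain 0 with amplitude 1.
    refine ⟨fun p => if i = p.rev then 1 else 0, by fin_cases i <;> rfl, fun p => ?_⟩
    fin_cases i <;> fin_cases p <;>
      simp [basesNL2, localNL2, ketZero, ketAngle, Matrix.mulVec, dotProduct, Fin.sum_univ_two,
        hs', h, -Complex.ofReal_cos, -Complex.ofReal_sin]

/-! ### Global antidistinguishability -/

theorem trace_density_mul {n : Type} [Fintype n] (ψ : n → ℂ) (E : Matrix n n ℂ) :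
    (density ψ * E).trace = star ψ ⬝ᵥ E.mulVec ψ := by
  rw [density, Matrix.vecMulVec_mul, Matrix.trace_vecMulVec, Matrix.dotProduct_mulVec,
    dotProduct_comm]

/-- Solve a + b = √(1+2x), a - b = √(1-2x). Strict positivity of `a` survives at x = 0, where b = 0,
and later makes a³ + b³ nonzero. -/
theorem exists_sq_add_sq_eq_one_mul_eq {x : ℝ} (h0 : 0 ≤ x) (h1 : x ≤ 1 / 2) :
    ∃ a b : ℝ, 0 < a ∧ 0 ≤ b ∧ a ^ 2 + b ^ 2 = 1 ∧ a * b = x := by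
  have hp := Real.sq_sqrt (show 0 ≤ 1 + 2 * x by linarith)
  have hm := Real.sq_sqrt (show 0 ≤ 1 - 2 * x by linarith)
  have hle : √(1 - 2 * x) ≤ √(1 + 2 * x) := Real.sqrt_le_sqrt (by linarith)
  have hpos : 0 < √(1 + 2 * x) := Real.sqrt_pos.mpr (by linarith)
  refine ⟨(√(1 + 2 * x) + √(1 - 2 * x)) / 2, (√(1 + 2 * x) - √(1 - 2 * x)) / 2, ?_, ?_, ?_, ?_⟩
  · have := Real.sqrt_nonneg (1 - 2 * x)
    positivity
  · linarith
  · linear_combination (hp + hm) / 2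
  · linear_combination (hp - hm) / 4

/-- Three unit vectors with equal pairwise overlaps `x ∈ [0, 1/2]` are antidistinguishable: they
are isometric to `(0, a, b)`, `(b, 0, a)`, `(a, b, 0)`. -/
theorem antidistinguishable_of_gram {n : Type} [Fintype n] [DecidableEq n] {ψ : Fin 3 → n → ℂ}
    {x : ℝ} (h0 : 0 ≤ x) (h1 : x ≤ 1 / 2)
    (hG : ∀ i j, star (ψ i) ⬝ᵥ ψ j = if i = j then 1 else (x : ℂ)) :
    Antidistinguishable fun i => density (ψ i) := by
  obtain ⟨a, b, ha, hb, hab, rfl⟩ := exists_sq_add_sq_eq_one_mul_eq h0 h1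
  have hab' : (a : ℂ) ^ 2 + (b : ℂ) ^ 2 = 1 := mod_cast hab
  set N : Matrix (Fin 3) (Fin 3) ℂ :=
    !![0, (b : ℂ), (a : ℂ); (a : ℂ), 0, (b : ℂ); (b : ℂ), (a : ℂ), 0] with hN
  set W : Matrix n (Fin 3) ℂ := Matrix.of fun y j => ψ j y with hW
  have hWN : W.conjTranspose * W = N.conjTranspose * N := by
    ext i j
    have : (W.conjTranspose * W) i j = star (ψ i) ⬝ᵥ ψ j := rfl
    rw [this, hG, Matrix.mul_apply, Fin.sum_univ_three]
    fin_cases i <;> fin_cases j <;> simp [hN, -Complex.ofReal_mul] <;> push_cast <;> grind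
  have hdet : IsUnit N.det := by
    have : N.det = ((a ^ 3 + b ^ 3 : ℝ) : ℂ) := by
      rw [hN, Matrix.det_fin_three]
      simp
      ring
    rw [this, isUnit_iff_ne_zero, Complex.ofReal_ne_zero]
    positivity
  have hNi : N⁻¹ * N = 1 := Matrix.nonsing_inv_mul N hdet
  have hNi' : N * N⁻¹ = 1 := Matrix.mul_nonsing_inv N hdet
  -- Equal Gram matrices and invertibility of `N` make V = W N⁻¹ an isometry taking the model
  -- vectors to the `ψ i`.
  obtain ⟨V, hVN, hV⟩ : ∃ V : Matrix n (Fin 3) ℂ, V * N = W ∧ V.conjTranspose * V = 1 := by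
    refine ⟨W * N⁻¹, by rw [Matrix.mul_assoc, hNi, Matrix.mul_one], ?_⟩
    rw [Matrix.conjTranspose_mul, Matrix.mul_assoc, ← Matrix.mul_assoc W.conjTranspose, hWN,
      Matrix.mul_assoc, hNi', Matrix.mul_one, ← Matrix.conjTranspose_mul, hNi',
      Matrix.conjTranspose_one]
  have hψ : ∀ i, ψ i = V.mulVec (N.col i) := fun i => by
    funext y
    exact (congrFun (congrFun hVN y) i).symm
  set Q : Matrix n n ℂ := 1 - V * V.conjTranspose with hQ
  have hVQ : V.conjTranspose * Q = 0 := by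
    rw [hQ, Matrix.mul_sub, ← Matrix.mul_assoc, hV, Matrix.mul_one, Matrix.one_mul, sub_self]
  have hQψ : ∀ i, star (ψ i) ⬝ᵥ Q.mulVec (ψ i) = 0 := fun i => by
    have : star (ψ i) = Matrix.vecMul (star (N.col i)) V.conjTranspose := by
      rw [hψ, Matrix.star_mulVec]
    rw [this, ← Matrix.dotProduct_mulVec, Matrix.mulVec_mulVec, hVQ, Matrix.zero_mulVec,
      dotProduct_zero]
  have hQpos : Q.PosSemidef := by
    have hQQ : Q = Q.conjTranspose * Q := by
      have hs : Q.conjTranspose = Q := by simp [hQ]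
      rw [hs]
      nth_rewrite 2 [hQ]
      rw [Matrix.sub_mul, Matrix.mul_assoc, hVQ, Matrix.mul_zero, Matrix.one_mul, sub_zero]
    rw [hQQ]
    exact Matrix.posSemidef_conjTranspose_mul_self Q
  have hsingle : ∀ i j, star (ψ i) ⬝ᵥ (V * Matrix.single j j (1 : ℂ) * V.conjTranspose).mulVec (ψ i)
      = star (N j i) * N j i := fun i j => by
    have hs : star (ψ i) = Matrix.vecMul (star (N.col i)) V.conjTranspose := by
      rw [hψ, Matrix.star_mulVec]
    rw [hs, ← Matrix.dotProduct_mulVec, Matrix.mulVec_mulVec, hψ, Matrix.mulVec_mulVec,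
      Matrix.mul_assoc, Matrix.mul_assoc, hV, Matrix.mul_one, ← Matrix.mul_assoc, hV,
      Matrix.one_mul, Matrix.single_mulVec]
    simp [dotProduct, Matrix.col, Function.update_apply]
  have htr : ∀ i j, star (ψ i) ⬝ᵥ (V * Matrix.single j j (1 : ℂ) * V.conjTranspose +
      if j = 0 then Q else 0).mulVec (ψ i) = star (N j i) * N j i := fun i j => by
    rw [Matrix.add_mulVec, dotProduct_add, hsingle]
    split_ifs
    · rw [hQψ, add_zero]
    · rw [Matrix.zero_mulVec, dotProduct_zero, add_zero]
  -- The projection `Q` onto the complement of the range of `V` completes the POVM; it vanishes on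
  -- all three states, so assigning it to outcome 0 is harmless.
  refine ⟨⟨fun j => V * Matrix.single j j (1 : ℂ) * V.conjTranspose + if j = 0 then Q else 0,
    fun j => ?_, ?_⟩, fun j => ?_, fun j => ?_⟩
  · refine Matrix.PosSemidef.add ?_ ?_
    · have : (Matrix.single j j (1 : ℂ)).PosSemidef := by
        rw [← Matrix.diagonal_single]
        exact Matrix.PosSemidef.diagonal (Pi.single_nonneg.mpr zero_le_one)
      exact this.mul_mul_conjTranspose_same V
    · split_ifs
      exacts [hQpos, .zero]
  · rw [Finset.sum_add_distrib, ← Matrix.sum_mul, ← Matrix.mul_sum, Matrix.sum_single_one,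
      Matrix.mul_one, Finset.sum_ite_eq' Finset.univ (0 : Fin 3) fun _ => Q,
      if_pos (Finset.mem_univ _), hQ]
    abel
  · rw [trace_density_mul, htr]
    fin_cases j <;> simp [hN]
  · simp only [trace_density_mul, htr]
    rw [Fin.sum_univ_three]
    fin_cases j <;> simp [hN] <;> nlinarith

theorem star_productState_dotProduct {P : Type} [Fintype P] [DecidableEq P] {D : P → Type}
    [∀ p, Fintype (D p)] (v w : ∀ p, D p → ℂ) :
    star (productState v) ⬝ᵥ productState w = ∏ p, star (v p) ⬝ᵥ w p := by
  simp only [dotProduct, productState, Pi.star_apply, star_prod, ← Finset.prod_mul_distrib]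
  rw [Finset.prod_univ_sum, Fintype.piFinset_univ]

/-- Two distinct states differ at exactly two parties, each contributing a factor cos θ. -/
theorem gram_stateNL2 (θ : ℝ) (i j : Fin 3) :
    star (stateNL2 θ i) ⬝ᵥ stateNL2 θ j = if i = j then 1 else ((Real.cos θ ^ 2 : ℝ) : ℂ) := by
  rw [stateNL2_eq, star_productState_dotProduct, Fin.prod_univ_three]
  fin_cases i <;> fin_cases j <;>
    simp only [localNL2, Fin.zero_eta, Fin.mk_one, Fin.reduceFinMk, Matrix.cons_val,
      Matrix.cons_val_zero, Matrix.cons_val_one, star_ketZero_dotProduct_self,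
      star_ketAngle_dotProduct_self, star_ketZero_dotProduct_ketAngle,
      star_ketAngle_dotProduct_ketZero, Fin.reduceEq, if_true, if_false, mul_one, one_mul,
      Complex.ofReal_mul, pow_two]

/-- A pair of configurations of two systems, split into the configurations of each system. -/
def splitPair (P d : Type) : (P → Fin 2 → d) ≃ (P → d) × (P → d) where
  toFun x := (fun p => x p 0, fun p => x p 1)
  invFun y p := ![y.1 p, y.2 p]
  left_inv x := by
    funext p k
    fin_cases k <;> rfl
  right_inv _ := rfl

open Kronecker in
theorem density_seqState_two {P d ι : Type} (ψ : ι → (P → d) → ℂ) (s : Fin 2 ↪ ι) :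
    density (seqState (D := fun _ => d) 2 ψ s)
      = (density (ψ (s 0)) ⊗ₖ density (ψ (s 1))).submatrix (splitPair P d) (splitPair P d) := by
  ext x y
  change (∏ k, ψ (s k) fun p => x p k) * star (∏ k, ψ (s k) fun p => y p k) =
    (ψ (s 0) fun p => x p 0) * star (ψ (s 0) fun p => y p 0) *
      ((ψ (s 1) fun p => x p 1) * star (ψ (s 1) fun p => y p 1))
  rw [Fin.prod_univ_two, Fin.prod_univ_two, star_mul']
  ring

theorem trace_submatrix_equiv {m n : Type} [Fintype m] [Fintype n] (A : Matrix n n ℂ) (e : m ≃ n) :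
    (A.submatrix e e).trace = A.trace :=
  Equiv.sum_comp e fun i => A i i

/-- Each first entry `j` has two continuations, counted by the bijection `s ↦ s 1` onto the indices
other than `j`. -/
theorem sum_embedding_apply_zero {M : Type} [AddCommMonoid M] (F : Fin 3 → M) :
    ∑ s : Fin 2 ↪ Fin 3, F (s 0) = 2 • ∑ j, F j := by
  rw [← Finset.sum_fiberwise Finset.univ (fun s : Fin 2 ↪ Fin 3 => s 0), Finset.smul_sum]
  refine Finset.sum_congr rfl fun j _ => ?_
  have hcard : (Finset.univ.filter fun s : Fin 2 ↪ Fin 3 => s 0 = j).card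
      = (Finset.univ.erase j).card := by
    refine Finset.card_nbij (fun s => s 1) (fun s hs => ?_) (fun s hs t ht hst => ?_)
      fun k hk => ?_
    · rw [Finset.mem_coe, Finset.mem_erase, ← (Finset.mem_filter.mp hs).2]
      exact ⟨fun h => absurd (s.injective h) (by decide), Finset.mem_univ _⟩
    · ext i
      fin_cases i
      · exact congrArg _ ((Finset.mem_filter.mp hs).2.trans (Finset.mem_filter.mp ht).2.symm)
      · exact congrArg _ hst
    · have hkj := Finset.ne_of_mem_erase hk
      refine ⟨⟨![j, k], fun a b hab => ?_⟩, Finset.mem_coe.mpr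
        (Finset.mem_filter.mpr ⟨Finset.mem_univ _, rfl⟩), rfl⟩
      fin_cases a <;> fin_cases b <;> simp_all [eq_comm]
  rw [Finset.card_erase_of_mem (Finset.mem_univ j), Finset.card_univ, Fintype.card_fin] at hcard
  calc ∑ s : Fin 2 ↪ Fin 3 with s 0 = j, F (s 0) = ∑ s : Fin 2 ↪ Fin 3 with s 0 = j, F j :=
        Finset.sum_congr rfl fun s hs => by rw [(Finset.mem_filter.mp hs).2]
    _ = 2 • F j := by rw [Finset.sum_const, hcard]

open Kronecker in
/-- If three unit vectors are antidistinguishable, so are the pairs of two distinct ones: measure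
the first system only. -/
theorem antidistinguishable_pairs {P d : Type} [Fintype P] [DecidableEq P] [Fintype d]
    [DecidableEq d] {ψ : Fin 3 → (P → d) → ℂ} (hψ : ∀ i, star (ψ i) ⬝ᵥ ψ i = 1)
    (h : Antidistinguishable fun i => density (ψ i)) :
    Antidistinguishable fun s => density (seqState (D := fun _ => d) 2 ψ s) := by
  obtain ⟨M, hM0, hMpos⟩ := h
  have hhalf : (0 : ℂ) ≤ 1 / 2 := by
    rw [Complex.le_def]
    norm_num
  have htr : ∀ s t : Fin 2 ↪ Fin 3, (density (seqState (D := fun _ => d) 2 ψ s) *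
      (M.effect (t 0) ⊗ₖ ((1 / 2 : ℂ) • (1 : Matrix (P → d) (P → d) ℂ))).submatrix
        (splitPair P d) (splitPair P d)).trace
      = (density (ψ (s 0)) * M.effect (t 0)).trace * (1 / 2) := fun s t => by
    rw [density_seqState_two, Matrix.submatrix_mul_equiv, trace_submatrix_equiv,
      ← Matrix.mul_kronecker_mul, Matrix.trace_kronecker, trace_density_mul (ψ (s 1)),
      Matrix.smul_mulVec, Matrix.one_mulVec, dotProduct_smul, hψ, smul_eq_mul, mul_one]
  -- The factor 1/2 shares outcome `t 0` equally between the two sequences that start with it.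
  refine ⟨⟨fun t => (M.effect (t 0) ⊗ₖ
    ((1 / 2 : ℂ) • (1 : Matrix (P → d) (P → d) ℂ))).submatrix (splitPair P d) (splitPair P d),
    fun t => ?_, ?_⟩, fun t => ?_, fun t => ?_⟩
  · exact ((M.posSemidef _).kronecker (Matrix.PosSemidef.one.smul hhalf)).submatrix _
  · rw [sum_embedding_apply_zero fun j => (M.effect j ⊗ₖ
      ((1 / 2 : ℂ) • (1 : Matrix (P → d) (P → d) ℂ))).submatrix (splitPair P d) (splitPair P d)]
    ext x y
    have hsum : ∀ u v, ∑ j, M.effect j u v = (1 : Matrix (P → d) (P → d) ℂ) u v := fun u v => by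
      rw [← M.sum_effect, Matrix.sum_apply]
    rw [Matrix.smul_apply, Matrix.sum_apply]
    simp only [Matrix.submatrix_apply, Matrix.kroneckerMap_apply, ← Finset.sum_mul, hsum,
      Matrix.smul_apply]
    rw [← Matrix.submatrix_one_equiv (splitPair P d), Matrix.submatrix_apply,
      ← Matrix.one_kronecker_one, Matrix.kroneckerMap_apply]
    simp
    ring
  · rw [htr]
    exact mul_eq_zero_of_left (hM0 (t 0)) _
  · simp only [htr]
    rw [sum_embedding_apply_zero fun i => ((density (ψ i) * M.effect (t 0)).trace * (1 / 2)).re]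
    have hre : ∀ z : ℂ, (z * (1 / 2)).re = z.re * (1 / 2) := fun z => by
      simp [Complex.mul_re]
    simp only [hre, ← Finset.sum_mul, nsmul_eq_mul]
    have := hMpos (t 0)
    push_cast
    linarith

end Antimarking

/-! ### Translation of the angle ranges into bounds on cos²θ. -/

theorem mainTheorem3 (θ : ℝ) (hθ : θ ∈ Set.Icc (Real.pi / 4) (3 * Real.pi / 4)) :
    -- the ensemble is globally antidistinguishable
    Antimarking.Antidistinguishable (fun i => Antimarking.density (Antimarking.stateNL2 θ i)) ∧
    -- so are the sequences of two distinct states of the ensemble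
    Antimarking.Antidistinguishable
      (fun s => Antimarking.density (Antimarking.seqState 2 (Antimarking.stateNL2 θ) s)) ∧
    -- it is locally conclusively distinguishable and markable
    Antimarking.AdmitsCLSD (Antimarking.stateNL2 θ) ∧
    (∀ n : ℕ, 1 ≤ n → n ≤ 3 → Antimarking.AdmitsCLSM n (Antimarking.stateNL2 θ)) ∧
    -- but it is not locally antimarkable
    (θ ∈ Set.Ico (Real.pi / 4) (Real.arccos (1 / √3)) ∪
        Set.Ioc (Real.arccos (-(1 / √3))) (3 * Real.pi / 4) →
      ¬ Antimarking.AdmitsLSAM 2 1 (Antimarking.stateNL2 θ)) := by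
  obtain ⟨hl, hr⟩ := hθ
  have hπ := Real.pi_pos
  have hsin : 0 < Real.sin θ := Real.sin_pos_of_pos_of_lt_pi (by linarith) (by linarith)
  have hcos2 : Real.cos (2 * θ) ≤ 0 :=
    Real.cos_nonpos_of_pi_div_two_le_of_le (by linarith) (by linarith)
  have hcos : Real.cos θ ^ 2 ≤ 1 / 2 := by
    rw [Real.cos_two_mul] at hcos2
    linarith
  have hb := Antimarking.conclusiveBasesNL2 hsin.ne'
  have had := Antimarking.antidistinguishable_of_gram (sq_nonneg _) hcos
    (Antimarking.gram_stateNL2 θ)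
  refine ⟨had, ?_, ?_, ?_, ?_⟩
  · refine Antimarking.antidistinguishable_pairs (fun i => ?_) had
    rw [Antimarking.gram_stateNL2, if_pos rfl]
  · rw [Antimarking.stateNL2_eq]
    exact hb.admitsCLSD
  · intro n _ _
    rw [Antimarking.stateNL2_eq]
    exact hb.admitsCLSM n
  · intro h
    have h3 : (1 / √3) ^ 2 = (1 : ℝ) / 3 := by
      rw [div_pow, Real.sq_sqrt (by norm_num), one_pow]
    have hpos : 0 < 1 / √3 := by positivity
    have hle : 1 / √3 ≤ 1 := by nlinarith
    refine Antimarking.not_admitsLSAM_two_one ?_ (by linarith)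
    rw [← h3]
    rcases h with ⟨_, h⟩ | ⟨h, _⟩
    · have := Real.cos_lt_cos_of_nonneg_of_le_pi (by linarith) (Real.arccos_le_pi _) h
      rw [Real.cos_arccos (by linarith) hle] at this
      exact pow_lt_pow_left₀ this hpos.le (by norm_num)
    -- On the second interval cos θ < -1/√3, and squaring reverses the inequality.
    · have := Real.cos_lt_cos_of_nonneg_of_le_pi (Real.arccos_nonneg _) (by linarith) h
      rw [Real.cos_arccos (by linarith) (by linarith)] at this
      nlinarith
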